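/- Let $AP$ be a finite set of atomic propositions. The formulas of $\mathsf{LTL}(\mathsf F,\mathsf G)$ are given by $\phi ::= a \mid \neg a \mid \phi\land\phi \mid \phi\lor\phi \mid \mathsf F\phi \mid \mathsf G\phi$ with $a\in AP$ and are interpreted over infinite sequences in $(2^{AP})^\omega$ as usual; $|\phi|$ is the number of literals, connectives and modalities in $\phi$. The formula $\phi$ is *fair* if the set of sequences satisfying it is closed under taking suffixes and under prepending finite sequences. A Kripke structure $\mathcal K=(S,\bar s,T,AP,L)$ has a finite set $S$ of states, an initial state $\bar s\in S$, a set $T\subseteq S\times S$ of transitions such that each state has a successor, and a labelling $L:S\to 2^{AP}$; put $|\mathcal K|=|S|+|T|$. The procedure $\mathtt{fairMC}(\phi,\mathcal K)$ checks whether all infinite paths of $\mathcal K$ from $\bar s$ satisfy the fair formula $\phi$: 1. Transform $\neg\phi$ (in positive normal form) syntactically into a fair normal form $\flat(\neg\phi)=\bigvee_{i=1}^m\bigl(\mathsf{FG}\,l_i\land\bigwedge_{j=1}^{n_i}\mathsf{GF}\,l_{i,j}\bigr)$ with propositional $l_i,l_{i,j}$. For this, put $\mathsf{GF}$ in front of $\neg\phi$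 and push $\mathsf{GF}$ and $\mathsf{FG}$ inwards to the maximal propositional subformulas. The rules are $\mathsf{GFF}\psi\equiv\mathsf{FGF}\psi\equiv\mathsf{GF}\psi$ and $\mathsf{GFG}\psi\equiv\mathsf{FGG}\psi\equiv\mathsf{FG}\psi$; the distribution of $\mathsf{GF}$ over $\lor$ and of $\mathsf{FG}$ over $\land$ (products of disjunctions being multiplied out); and, for a non-propositional operand $\chi$ that is a conjunction below $M=\mathsf{GF}$ or a disjunction below $M=\mathsf{FG}$, the rule $M\chi\equiv\bigvee_{J}\bigl(M\chi[J]\land\bigwedge_{j\in J}M m_j\bigr)$. Here $m_1,\dots,m_r$ are the outermost modal subformulas of $\chi$, $J$ ranges over the subsets of $\{1,\dots,r\}$, and $\chi[J]$ is the propositional formula obtained from $\chi$ by replacing $m_j$ by true if $j\in J$ and by false otherwise. (This rule results from the normal forms $\chi\equiv\bigvee_J(\chi[J]\land\bigwedge_{j\in J}m_j)\equiv\bigwedge_J(\chi[J]\lor\bigvee_{j\notin J}m_j)$.) 2. For each $i$, let $B$ be the set of the states that are reachable from $\bar s$ and satisfy $l_i$. If $B\ne\emptyset$, compute the maximal strongly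 connected components of the subgraph induced by $B$ by depth-first search in this graph and in its reversal. If one of them is nontrivial (not a single state without a self loop) and contains for each $j$ a state satisfying $l_{i,j}$, return False. 3. If no such component was found for any $i$, return True. Time is the number of elementary steps of the procedure, and space the maximal number of memory cells in use at the same time (including the input), on a random access machine with unit costs; a cell holds one node of a syntax tree or a list, one stack entry, one state label or one array component, and testing whether a proposition belongs to a state label is one step. **Theorem.** On fair $\mathsf{LTL}(\mathsf F,\mathsf G)$ formulas, $\mathtt{fairMC}(\phi,\mathcal K)$ runs in time $\mathcal O(|\mathcal K|\cdot 2^{|\phi|})$ and in space $\mathcal O(|\mathcal K|+|\phi|\cdot 2^{|\phi|})$. That is, there is a constant $C$ such that for every finite set $AP$, every Kripke structure $\mathcal K$ and every fair formula $\phi\in\mathsf{LTL}(\mathsf F,\mathsf G)$ over $AP$, the time is at most $C\cdot|\mathcal K|\cdot 2^{|\phi|}$ and the space is at most $C\cdot(|\mathcal K|+|\phi|\cdot 2^{|\phi|})$. -/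

import Mathlib

namespace FairLTL

/-! ### Formulas with the modalities `F` and `G`, their semantics, and fairness -/

/-- Formulas of `LTL(F, G)` in positive normal form over the atomic propositions `AP`:
`a`, `¬ a`, `φ ∧ ψ`, `φ ∨ ψ`, `F φ` (`ev`) and `G φ` (`alw`). -/
inductive Formula (AP : Type) : Type
  | pos (a : AP) : Formula AP
  | neg (a : AP) : Formula AP
  | and (φ ψ : Formula AP) : Formula AP
  | or (φ ψ : Formula AP) : Formula AP
  | ev (φ : Formula AP) : Formula AP
  | alw (φ : Formula AP) : Formula AP

namespace Formula

variable {AP : Type}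

/-- The size of a formula: the number of its literals, connectives and modalities, counted with
repetitions. -/
def size : Formula AP → ℕ
  | pos _ => 1
  | neg _ => 1
  | and φ ψ => φ.size + ψ.size + 1
  | or φ ψ => φ.size + ψ.size + 1
  | ev φ => φ.size + 1
  | alw φ => φ.size + 1

/-- Satisfaction of a formula by an infinite sequence of sets of atomic propositions. -/
def Sat : Stream' (Finset AP) → Formula AP → Prop
  | ρ, pos a => a ∈ ρ.get 0
  | ρ, neg a => a ∉ ρ.get 0
  | ρ, and φ ψ => Sat ρ φ ∧ Sat ρ ψ
  | ρ, or φ ψ => Sat ρ φ ∨ Sat ρ ψ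
  | ρ, ev φ => ∃ i, Sat (ρ.drop i) φ
  | ρ, alw φ => ∀ i, Sat (ρ.drop i) φ

/-- A formula is a fairness (a fair formula) if the set of sequences satisfying it is closed
under taking suffixes and under prepending finite sequences. -/
def IsFair (φ : Formula AP) : Prop :=
  ∀ ρ : Stream' (Finset AP), Sat ρ φ →
    (∀ i, Sat (ρ.drop i) φ) ∧ (∀ w : List (Finset AP), Sat (w ++ₛ ρ) φ)

end Formula

/-! ### Kripke structures -/

/-- A Kripke structure with state set `S`: an initial state, a set of transitions in which each
state has a successor, and a labelling of the states by sets of atomic propositions. -/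
structure Kripke (AP S : Type) where
  init : S
  trans : Finset (S × S)
  label : S → Finset AP
  total : ∀ s, ∃ t, (s, t) ∈ trans

/-- The size of a Kripke structure: the number of its states and transitions. -/
def Kripke.size {AP S : Type} [Fintype S] (K : Kripke AP S) : ℕ :=
  Fintype.card S + K.trans.card

/-! ### The cost model

Programs are written in a state monad that meters the elementary steps and the memory cells of a
random access machine with unit costs. A memory cell holds one record of bounded length: one node
of a syntax tree or of a linked list, one entry of a stack, the label of one state, or one
component of an array. An array that is indexed by the states is modelled by a function on `S`. -/

/-- The number of steps made so far, the number of cells in use now, and the largest number of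
cells that have been in use at the same time. -/
structure Meter where
  time : ℕ
  live : ℕ
  peak : ℕ

/-- Metered computations. -/
abbrev Comp := StateM Meter

/-- One elementary step: a bounded number of tests, memory accesses, and calls. -/
def tick : Comp Unit :=
  modify fun m => { m with time := m.time + 1 }

/-- Allocating and initialising `n` cells takes `n` steps. -/
def alloc (n : ℕ) : Comp Unit :=
  modify fun m =>
    { time := m.time + n, live := m.live + n, peak := max m.peak (m.live + n) }

/-- Releasing `n` cells takes `n` steps. -/
def free (n : ℕ) : Comp Unit :=
  modify fun m => { m with time := m.time + n, live := m.live - n }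

/-! #### Linked lists -/

section Lists

variable {α β γ : Type}

def appendC : List α → List α → Comp (List α)
  | [], ys => do
    tick
    return ys
  | x :: xs, ys => do
    tick
    let zs ← appendC xs ys
    alloc 1
    return x :: zs

def mapC (f : α → Comp β) : List α → Comp (List β)
  | [] => do
    tick
    return []
  | x :: xs => do
    tick
    let y ← f x
    let ys ← mapC f xs
    alloc 1
    return y :: ys

def filterMapC (f : α → Comp (Option β)) : List α → Comp (List β)
  | [] => do
    tick
    return []
  | x :: xs => do
    tick
    match ← f x with
    | none => filterMapC f xs
    | some y => do
      let ys ← filterMapC f xs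
      alloc 1
      return y :: ys

/-- The list of all `f x y` with `x` in the first and `y` in the second list. -/
def prodC (f : α → β → Comp γ) : List α → List β → Comp (List γ)
  | [], _ => do
    tick
    return []
  | x :: xs, ys => do
    tick
    let zs ← mapC (f x) ys
    let rest ← prodC f xs ys
    appendC zs rest

end Lists

/-! ### The fair normal form -/

/-- Propositional formulas (in positive normal form, with the constants true and false). -/
inductive PForm (AP : Type) : Type
  | tt : PForm AP
  | ff : PForm AP
  | pos (a : AP) : PForm AP
  | neg (a : AP) : PForm AP
  | and (p q : PForm AP) : PForm AP
  | or (p q : PForm AP) : PForm AP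

/-- One disjunct `F G l ∧ ⋀ⱼ G F lⱼ` of a fair normal form, with `l = always` and the `lⱼ`
listed in `often`. -/
structure Disjunct (AP : Type) where
  always : PForm AP
  often : List (PForm AP)

/-- The modality `G F` or `F G`. -/
inductive Mode : Type
  | gf : Mode
  | fg : Mode

section Flatten

variable {AP : Type}

/-- The negation of a formula, in positive normal form. -/
def negC : Formula AP → Comp (Formula AP)
  | .pos a => do
    alloc 1
    return .neg a
  | .neg a => do
    alloc 1
    return .pos a
  | .and φ ψ => do
    let φ' ← negC φ
    let ψ' ← negC ψ
    alloc 1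
    return .or φ' ψ'
  | .or φ ψ => do
    let φ' ← negC φ
    let ψ' ← negC ψ
    alloc 1
    return .and φ' ψ'
  | .ev φ => do
    let φ' ← negC φ
    alloc 1
    return .alw φ'
  | .alw φ => do
    let φ' ← negC φ
    alloc 1
    return .ev φ'

/-- Tests whether a formula is propositional, and if so returns it as a propositional formula. -/
def toPropC : Formula AP → Comp (Option (PForm AP))
  | .pos a => do
    alloc 1
    return some (.pos a)
  | .neg a => do
    alloc 1
    return some (.neg a)
  | .and φ ψ => do
    tick
    match ← toPropC φ, ← toPropC ψ with
    | some p, some q => do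
      alloc 1
      return some (.and p q)
    | _, _ => return none
  | .or φ ψ => do
    tick
    match ← toPropC φ, ← toPropC ψ with
    | some p, some q => do
      alloc 1
      return some (.or p q)
    | _, _ => return none
  | .ev _ => do
    tick
    return none
  | .alw _ => do
    tick
    return none

/-- Conjunction of propositional formulas, with the constants simplified. -/
def andC (p q : PForm AP) : Comp (PForm AP) := do
  tick
  match p, q with
  | .ff, _ => return .ff
  | _, .ff => return .ff
  | .tt, q => return q
  | p, .tt => return p
  | p, q => do
    alloc 1
    return .and p q

/-- Disjunction of propositional formulas, with the constants simplified. -/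
def orC (p q : PForm AP) : Comp (PForm AP) := do
  tick
  match p, q with
  | .tt, _ => return .tt
  | _, .tt => return .tt
  | .ff, q => return q
  | p, .ff => return p
  | p, q => do
    alloc 1
    return .or p q

/-- The trivially true disjunct. -/
def oneC : Comp (Disjunct AP) := do
  alloc 1
  return ⟨.tt, []⟩

/-- The conjunction of two disjuncts, by `F G l ∧ F G l' ≡ F G (l ∧ l')`. -/
def mulC (d e : Disjunct AP) : Comp (Disjunct AP) := do
  let l ← andC d.always e.always
  let ls ← appendC d.often e.often
  alloc 1
  return ⟨l, ls⟩

/-- The conjunction of `G F l` or `F G l` with a disjunct. It is dropped if `l` is the constant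
false, and `l` is omitted if it is the constant true. -/
def attachC (m : Mode) : PForm AP × Disjunct AP → Comp (Option (Disjunct AP))
  | (.ff, _) => do
    tick
    return none
  | (.tt, d) => do
    tick
    return some d
  | (l, d) => do
    tick
    match m with
    | .gf => do
      alloc 2
      return some ⟨d.always, l :: d.often⟩
    | .fg => do
      let l' ← andC l d.always
      alloc 1
      return some ⟨l', d.often⟩

/-- Applies `G F` or `F G` to a formula that has been expanded by `expandC`. -/
def attachAllC (m : Mode) (es : List (PForm AP × Disjunct AP)) : Comp (List (Disjunct AP)) :=
  filterMapC (attachC m) es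

/-- The conjunction of two formulas that have been expanded by `expandC`. -/
def expandAndC (es fs : List (PForm AP × Disjunct AP)) :
    Comp (List (PForm AP × Disjunct AP)) :=
  prodC (fun x y => do
    let l ← andC x.1 y.1
    let d ← mulC x.2 y.2
    alloc 1
    return (l, d)) es fs

/-- The disjunction of two formulas that have been expanded by `expandC`. -/
def expandOrC (es fs : List (PForm AP × Disjunct AP)) :
    Comp (List (PForm AP × Disjunct AP)) :=
  prodC (fun x y => do
    let l ← orC x.1 y.1
    let d ← mulC x.2 y.2
    alloc 1
    return (l, d)) es fs

mutual

/-- The fair normal form of `G F φ` and of `F G φ`, as the list of its disjuncts.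

* A propositional `φ` is in its place already.
* `G F F φ ≡ G F φ`, `G F G φ ≡ F G φ`, `F G F φ ≡ G F φ`, `F G G φ ≡ F G φ`.
* `G F (φ ∨ ψ) ≡ G F φ ∨ G F ψ` and `F G (φ ∧ ψ) ≡ F G φ ∧ F G ψ`.
* `G F (φ ∧ ψ)` and `F G (φ ∨ ψ)`: the operand `χ` is put into disjunctive or conjunctive normal
  form with its outermost modal subformulas `m₁, …, mᵣ` as the atoms. These forms are
  `⋁ J, (χ[J] ∧ ⋀ j ∈ J, mⱼ)` and `⋀ J, (χ[J] ∨ ⋁ j ∉ J, mⱼ)`, where `J` runs over the subsets of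
  `{1, …, r}` and the propositional formula `χ[J]` is `χ` with `mⱼ` replaced by true for `j ∈ J`
  and by false for `j ∉ J`. With `M ∈ {G F, F G}` in front, `M` is pushed inwards through `∨` or
  `∧`, and by `G F (l ∧ F ψ) ≡ G F l ∧ G F ψ`, `G F (l ∧ G ψ) ≡ G F l ∧ F G ψ`,
  `F G (l ∨ F ψ) ≡ F G l ∨ G F ψ`, `F G (l ∨ G ψ) ≡ F G l ∨ F G ψ`, and the result has (after
  absorption, if `M = F G`) the disjunctive form `⋁ J, (M χ[J] ∧ ⋀ j ∈ J, M mⱼ)`, in which the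
  `M mⱼ` are replaced by their own fair normal forms. -/
def flatC : Formula AP → Mode → Comp (List (Disjunct AP))
  | .pos a, m => do
    tick
    alloc 1
    let d ← oneC
    alloc 2
    attachAllC m [(.pos a, d)]
  | .neg a, m => do
    tick
    alloc 1
    let d ← oneC
    alloc 2
    attachAllC m [(.neg a, d)]
  | .ev φ, _ => do
    tick
    flatC φ .gf
  | .alw φ, _ => do
    tick
    flatC φ .fg
  | .and φ ψ, m => do
    tick
    match ← toPropC (.and φ ψ) with
    | some p => do
      let d ← oneC
      alloc 2
      attachAllC m [(p, d)]
    | none =>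
      match m with
      | .fg => do
        let ds ← flatC φ .fg
        let es ← flatC ψ .fg
        prodC mulC ds es
      | .gf => do
        let xs ← expandC φ
        let ys ← expandC ψ
        let zs ← expandAndC xs ys
        attachAllC .gf zs
  | .or φ ψ, m => do
    tick
    match ← toPropC (.or φ ψ) with
    | some p => do
      let d ← oneC
      alloc 2
      attachAllC m [(p, d)]
    | none =>
      match m with
      | .gf => do
        let ds ← flatC φ .gf
        let es ← flatC ψ .gf
        appendC ds es
      | .fg => do
        let xs ← expandC φ
        let ys ← expandC ψ
        let zs ← expandOrC xs ys
        attachAllC .fg zs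

/-- The list of the pairs `(χ[J], d)`, where `J` is a set of outermost modal subformulas of `χ`
and `d` is a disjunct of the fair normal form of the conjunction of the `G F ψ` with `F ψ` in `J`
and the `F G ψ` with `G ψ` in `J`. -/
def expandC : Formula AP → Comp (List (PForm AP × Disjunct AP))
  | .pos a => do
    tick
    alloc 1
    let d ← oneC
    alloc 2
    return [(.pos a, d)]
  | .neg a => do
    tick
    alloc 1
    let d ← oneC
    alloc 2
    return [(.neg a, d)]
  | .and φ ψ => do
    tick
    let xs ← expandC φ
    let ys ← expandC ψ
    expandAndC xs ys
  | .or φ ψ => do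
    tick
    let xs ← expandC φ
    let ys ← expandC ψ
    expandOrC xs ys
  | .ev φ => do
    tick
    let ds ← flatC φ .gf
    let xs ← mapC (fun d => do
      alloc 1
      return (PForm.tt, d)) ds
    let d ← oneC
    alloc 2
    return (.ff, d) :: xs
  | .alw φ => do
    tick
    let ds ← flatC φ .fg
    let xs ← mapC (fun d => do
      alloc 1
      return (PForm.tt, d)) ds
    let d ← oneC
    alloc 2
    return (.ff, d) :: xs

end

/-- The flatten operation: the fair normal form of a fair formula `φ`, obtained from
`φ ≡ G F φ`. -/
def flattenC (φ : Formula AP) : Comp (List (Disjunct AP)) :=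
  flatC φ .gf

end Flatten

/-! ### The search for accepting strongly connected components -/

section Search

variable {AP S : Type} [DecidableEq AP] [DecidableEq S]

/-- Whether a propositional formula holds at a state with label `A`. -/
def evalC (A : Finset AP) : PForm AP → Comp Bool
  | .tt => do
    tick
    return true
  | .ff => do
    tick
    return false
  | .pos a => do
    tick
    return decide (a ∈ A)
  | .neg a => do
    tick
    return decide (a ∉ A)
  | .and p q => do
    tick
    let b ← evalC A p
    let c ← evalC A q
    return b && c
  | .or p q => do
    tick
    let b ← evalC A p
    let c ← evalC A q
    return b || c

/-- Enters the transitions of a list into an array of adjacency lists. -/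
def adjC : List (S × S) → Comp (S → List S)
  | [] => do
    tick
    return fun _ => []
  | (s, t) :: es => do
    tick
    let adj ← adjC es
    alloc 1
    return Function.update adj s (t :: adj s)

/-- Enters the reversed transitions of a list into an array of adjacency lists. -/
def revAdjC : List (S × S) → Comp (S → List S)
  | [] => do
    tick
    return fun _ => []
  | (s, t) :: es => do
    tick
    let adj ← revAdjC es
    alloc 1
    return Function.update adj t (s :: adj t)

/-- Marking an unmarked state decreases the number of unmarked states. -/
theorem card_unmarked_update_lt [Fintype S] (vis : S → Bool) (w : S) (h : vis w = false) :
    (Finset.univ.filter fun s => Function.update vis w true s = false).card <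
      (Finset.univ.filter fun s => vis s = false).card := by
  apply Finset.card_lt_card
  rw [Finset.ssubset_iff_of_subset]
  · exact ⟨w, by simp [h], by simp⟩
  · intro s hs
    by_cases hsw : s = w
    · subst hsw
      simp at hs
    · simpa [Function.update_of_ne hsw] using hs

/-- Depth-first search in the subgraph induced by the set `B`. An entry of the stack is a visited
state with the part of its adjacency list that is still to be explored; `vis` marks the visited
states. The states are put in front of `out` when they are finished. -/
def dfsC [Fintype S] (adj : S → List S) (B : S → Bool) (vis : S → Bool) (stack : List (S × List S))
    (out : List S) : Comp ((S → Bool) × List S) :=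
  match stack with
  | [] => do
    tick
    return (vis, out)
  | (v, []) :: st => do
    tick
    free 1
    alloc 1
    dfsC adj B vis st (v :: out)
  | (v, w :: ws) :: st => do
    tick
    if h : B w = true ∧ vis w = false then
      alloc 1
      dfsC adj B (Function.update vis w true) ((w, adj w) :: (v, ws) :: st) out
    else
      dfsC adj B vis ((v, ws) :: st) out
termination_by
  ((Finset.univ.filter fun s => vis s = false).card,
    (stack.map fun e => e.2.length + 1).sum)
decreasing_by
  · apply Prod.Lex.right
    simp
  · exact Prod.Lex.left _ _ (card_unmarked_update_lt vis w h.2)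
  · apply Prod.Lex.right
    simp only [List.map_cons, List.sum_cons, List.length_cons]
    omega

/-- Depth-first search from an unvisited state `r`. -/
def searchFromC [Fintype S] (adj : S → List S) (B : S → Bool) (vis : S → Bool) (r : S) (out : List S) :
    Comp ((S → Bool) × List S) := do
  tick
  alloc 1
  dfsC adj B (Function.update vis r true) [(r, adj r)] out

/-- Depth-first search in the subgraph induced by `B`, from all states in a list; the visited
states are collected in reverse order of finishing. -/
def searchAllC [Fintype S] (adj : S → List S) (B : S → Bool) :
    List S → (S → Bool) → List S → Comp (List S)
  | [], _, out => do
    tick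
    return out
  | r :: rs, vis, out => do
    tick
    if B r = true ∧ vis r = false then
      let (vis', out') ← searchFromC adj B vis r out
      searchAllC adj B rs vis' out'
    else
      searchAllC adj B rs vis out

/-- Whether `s` occurs in a list. -/
def memC (s : S) : List S → Comp Bool
  | [] => do
    tick
    return false
  | t :: ts => do
    tick
    if t = s then return true else memC s ts

/-- Whether the propositional formula `l` holds at some state in a list. -/
def existsC (label : S → Finset AP) (l : PForm AP) : List S → Comp Bool
  | [] => do
    tick
    return false
  | s :: ss => do
    tick
    let b ← evalC (label s) l
    if b then return true else existsC label l ss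

/-- Whether each of the given propositional formulas holds at some state in the list `c`. -/
def allOftenC (label : S → Finset AP) (c : List S) : List (PForm AP) → Comp Bool
  | [] => do
    tick
    return true
  | l :: ls => do
    tick
    let b ← existsC label l c
    if b then allOftenC label c ls else return false

/-- Whether a strongly connected component `c` is nontrivial, that is, not a single state
without a self loop. -/
def nontrivialC (adj : S → List S) : List S → Comp Bool
  | [] => do
    tick
    return false
  | [s] => do
    tick
    memC s (adj s)
  | _ :: _ :: _ => do
    tick
    return true

/-- Whether a strongly connected component `c`, all of whose states satisfy `d.always`, is
(nontrivial and) accepting for the disjunct `d`. -/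
def acceptingC (label : S → Finset AP) (adj : S → List S) (d : Disjunct AP) (c : List S) :
    Comp Bool := do
  let b ← nontrivialC adj c
  if b then allOftenC label c d.often else return false

/-- The loop over the strongly connected components of the subgraph induced by `B`. They are the
trees of a depth-first search in the reversed graph, with the roots taken in reverse order of
finishing of a search in the graph itself. The result is whether one of them is accepting. -/
def componentsC [Fintype S] (label : S → Finset AP) (adj radj : S → List S) (B : S → Bool)
    (d : Disjunct AP) : List S → (S → Bool) → Comp Bool
  | [], _ => do
    tick
    return false
  | r :: rs, vis => do
    tick
    if vis r = false then
      let (vis', c) ← searchFromC radj B vis r []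
      let b ← acceptingC label adj d c
      free c.length
      if b then return true else componentsC label adj radj B d rs vis'
    else
      componentsC label adj radj B d rs vis

/-- Enters into an array which of the states in a list are reachable and satisfy `l`. -/
def satSetC (label : S → Finset AP) (reach : S → Bool) (l : PForm AP) :
    List S → Comp (S → Bool)
  | [] => do
    tick
    return fun _ => false
  | s :: ss => do
    tick
    let B ← satSetC label reach l ss
    if reach s then
      let b ← evalC (label s) l
      return Function.update B s b
    else
      return B

/-- Whether the set `B` contains a state from a list. -/
def nonemptyC (B : S → Bool) : List S → Comp Bool
  | [] => do
    tick
    return false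
  | s :: ss => do
    tick
    if B s then return true else nonemptyC B ss

/-- The body of the main loop: whether there is a reachable strongly connected component that is
accepting for the disjunct `d`. All working memory is released at the end. -/
def checkC [Fintype S] (label : S → Finset AP) (states : List S) (adj radj : S → List S) (reach : S → Bool)
    (d : Disjunct AP) : Comp Bool := do
  alloc states.length
  let B ← satSetC label reach d.always states
  let ne ← nonemptyC B states
  if ne then
    alloc states.length
    let order ← searchAllC adj B states (fun _ => false) []
    free states.length
    alloc states.length
    let b ← componentsC label adj radj B d order (fun _ => false)
    free states.length
    free order.length
    free states.length
    return b
  else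
    free states.length
    return false

/-- The main loop over the disjuncts of the fair normal form of the negated formula. -/
def loopC [Fintype S] (label : S → Finset AP) (states : List S) (adj radj : S → List S) (reach : S → Bool) :
    List (Disjunct AP) → Comp Bool
  | [] => do
    tick
    return true
  | d :: ds => do
    tick
    let b ← checkC label states adj radj reach d
    if b then return false else loopC label states adj radj reach ds

/-- The procedure on a Kripke structure that is given by a list of its states, a list of its
transitions, the labels and the initial state. -/
def fairMCListC [Fintype S] (states : List S) (edges : List (S × S)) (label : S → Finset AP) (init : S)
    (φ : Formula AP) : Comp Bool := do
  let ψ ← negC φ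
  let ds ← flattenC ψ
  alloc states.length
  let adj ← adjC edges
  alloc states.length
  let radj ← revAdjC edges
  alloc states.length
  let (reach, out) ← searchFromC adj (fun _ => true) (fun _ => false) init []
  free out.length
  loopC label states adj radj reach ds

/-- The procedure `fairMC`, which checks whether all paths of the Kripke structure `K` from its
initial state satisfy the fair formula `φ`. The states and the transitions are listed in an
arbitrary order. -/
noncomputable def fairMC [Fintype S] (K : Kripke AP S) (φ : Formula AP) : Comp Bool :=
  fairMCListC Finset.univ.toList K.trans.toList K.label K.init φ

/-- The meter after running `fairMC` on `K` and `φ`. The memory that holds the input is counted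
from the beginning. -/
noncomputable def fairMCMeter [Fintype S] (K : Kripke AP S) (φ : Formula AP) : Meter :=
  (StateT.run (fairMC K φ) ⟨0, K.size + φ.size, K.size + φ.size⟩).2

/-- The running time of `fairMC`: the number of its steps. -/
noncomputable def fairMCTime [Fintype S] (K : Kripke AP S) (φ : Formula AP) : ℕ :=
  (fairMCMeter K φ).time

/-- The space used by `fairMC`: the largest number of memory cells in use at the same time. -/
noncomputable def fairMCSpace [Fintype S] (K : Kripke AP S) (φ : Formula AP) : ℕ :=
  (fairMCMeter K φ).peak

end Search

end FairLTL

-- The point is that the fair normal form has far fewer than `2 ^ n` disjuncts for a formula of size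
-- `n`, with enough room left to absorb polynomial factors. Write `c n` for `countBound n`, the
-- integer part of `(3/2) ^ (n + 1)`. Disjunct counts multiply at a product, add at a concatenation,
-- and grow by one where a modal subformula is expanded as true or false. All three are compatible
-- with `c`: the exponents `a + 1` and `b + 1` add up to the exponent for `a + b + 1`, and for
-- values at least 2 a product dominates a sum and a factor `3/2` dominates adding 1. A single
-- disjunct has only linear size, at most `4 * n`, because forming it adds boundedly many cells per
-- node of the formula. So the normal form costs at most a constant times `n ^ 2 * c n` steps
-- (`flatWithin_and_expandWithin`). Allocation is charged per cell, so the same number bounds its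
-- memory. Since `3/2 < 2`, `n ^ 2 * c n` is `O(2 ^ n)` (`sq_mul_countBound_le`).
--
-- For one disjunct of weight `w`, the graph search takes `O(|S| * w + |T|)` steps (`wp_checkC`).
-- This is an amortised count: each state, when it is marked, pays for its adjacency list, and the
-- components are disjoint, so the formula evaluations inside them add up to one pass over the
-- states (`wp_dfsC`, `wp_componentsC`). With `w ≤ 4 * n` and at most `c n` disjuncts, the loop
-- takes `O(|K| * n * c n)` steps, which is within the time bound.
--
-- For space, every round of the loop releases its working memory of at most `4 * |S|` cells
-- (`wp_loopC`). Hence the memory for the graph is added to that for the normal form and is not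
-- multiplied by the number of disjuncts.

namespace FairLTL

/-! ### Reasoning about metered computations -/

section Metered

variable {α β γ : Type}

/-- Weakest precondition of a metered computation. -/
def Wp (c : Comp α) (Q : α → Meter → Prop) (m : Meter) : Prop :=
  let r : α × Meter := StateT.run c m
  Q r.1 r.2

theorem wp_bind {c : Comp α} {f : α → Comp β} {Q : β → Meter → Prop} {m : Meter} :
    Wp (c >>= f) Q m ↔ Wp c (fun x m' => Wp (f x) Q m') m := Iff.rfl

theorem wp_pure {x : α} {Q : α → Meter → Prop} {m : Meter} :
    Wp (pure x) Q m ↔ Q x m := Iff.rfl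

theorem wp_tick {Q : Unit → Meter → Prop} {m : Meter} :
    Wp tick Q m ↔ Q () ⟨m.time + 1, m.live, m.peak⟩ := Iff.rfl

theorem wp_alloc {n : ℕ} {Q : Unit → Meter → Prop} {m : Meter} :
    Wp (alloc n) Q m ↔ Q () ⟨m.time + n, m.live + n, max m.peak (m.live + n)⟩ := Iff.rfl

theorem wp_free {n : ℕ} {Q : Unit → Meter → Prop} {m : Meter} :
    Wp (free n) Q m ↔ Q () ⟨m.time + n, m.live - n, m.peak⟩ := Iff.rfl

theorem Wp.mono {c : Comp α} {Q R : α → Meter → Prop} {m : Meter} (h : Wp c Q m)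
    (hQR : ∀ x m', Q x m' → R x m') : Wp c R m := hQR _ _ h

/-- The computation makes at most `t` steps, uses at most `t` new cells, and its result
satisfies `Q`. -/
def Within (c : Comp α) (t : ℕ) (Q : α → Prop) : Prop :=
  ∀ m, Wp c (fun x m' => m'.time ≤ m.time + t ∧ m'.live ≤ m.live + t ∧
    m'.peak ≤ max m.peak (m.live + t) ∧ Q x) m

namespace Within

theorem mono {c : Comp α} {t t' : ℕ} {Q Q' : α → Prop} (h : Within c t Q) (ht : t ≤ t')
    (hQ : ∀ x, Q x → Q' x) : Within c t' Q' := fun m =>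
  (h m).mono fun x m' ⟨h1, h2, h3, h4⟩ => ⟨by omega, by omega, by omega, hQ x h4⟩

theorem le {c : Comp α} {t t' : ℕ} {Q : α → Prop} (h : Within c t Q) (ht : t ≤ t') :
    Within c t' Q := h.mono ht fun _ => id

protected theorem pure {x : α} {Q : α → Prop} (h : Q x) : Within (pure x) 0 Q := fun _ =>
  wp_pure.2 ⟨by omega, by omega, by omega, h⟩

protected theorem bind {c : Comp α} {f : α → Comp β} {t t' : ℕ} {P : α → Prop} {Q : β → Prop}
    (hc : Within c t P) (hf : ∀ x, P x → Within (f x) t' Q) : Within (c >>= f) (t + t') Q :=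
  fun m => wp_bind.2 <| (hc m).mono fun x m' ⟨h1, h2, h3, h4⟩ =>
    (hf x h4 m').mono fun y m'' ⟨k1, k2, k3, k4⟩ => ⟨by omega, by omega, by omega, k4⟩

theorem tick : Within tick 1 fun _ => True := fun m =>
  wp_tick.2 ⟨le_rfl, by simp, by simp, trivial⟩

theorem alloc (n : ℕ) : Within (alloc n) n fun _ => True := fun _ =>
  wp_alloc.2 ⟨le_rfl, le_rfl, le_rfl, trivial⟩

theorem tick_bind {f : Unit → Comp β} {t : ℕ} {Q : β → Prop} (h : Within (f ()) t Q) :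
    Within (FairLTL.tick >>= f) (1 + t) Q := tick.bind fun _ _ => h

theorem alloc_bind {n : ℕ} {f : Unit → Comp β} {t : ℕ} {Q : β → Prop} (h : Within (f ()) t Q) :
    Within (FairLTL.alloc n >>= f) (n + t) Q := (alloc n).bind fun _ _ => h

theorem alloc_pure {n : ℕ} {x : α} {Q : α → Prop} (h : Q x) :
    Within (FairLTL.alloc n >>= fun _ => pure x) n Q :=
  alloc_bind (f := fun _ => pure x) (.pure h)

theorem tick_pure {x : α} {Q : α → Prop} (h : Q x) :
    Within (FairLTL.tick >>= fun _ => pure x) 1 Q :=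
  tick_bind (f := fun _ => pure x) (.pure h)

theorem appendC (xs ys : List α) :
    Within (appendC xs ys) (2 * xs.length + 1) fun zs => zs = xs ++ ys := by
  induction xs with
  | nil => exact tick_pure rfl
  | cons x xs ih =>
    refine le (tick_bind <| ih.bind fun zs hz => alloc_pure (by simp [hz])) ?_
    simp only [List.length_cons]; omega

theorem mapC {f : α → Comp β} {t : ℕ} {Q : β → Prop} {xs : List α}
    (hf : ∀ x ∈ xs, Within (f x) t Q) :
    Within (mapC f xs) (xs.length * (t + 2) + 1)
      fun ys => ys.length = xs.length ∧ ∀ y ∈ ys, Q y := by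
  induction xs with
  | nil => exact (tick_pure (by simp)).le (by simp)
  | cons x xs ih =>
    refine le (tick_bind <| (hf x (by simp)).bind fun y hy =>
      (ih fun z hz => hf z (by simp [hz])).bind fun ys hys => alloc_pure ?_) ?_
    · simpa [hys.1] using ⟨hy, hys.2⟩
    · simp only [List.length_cons, Nat.succ_mul]; omega

theorem filterMapC {f : α → Comp (Option β)} {t : ℕ} {Q : β → Prop} {xs : List α}
    (hf : ∀ x ∈ xs, Within (f x) t fun o => ∀ y ∈ o, Q y) :
    Within (filterMapC f xs) (xs.length * (t + 2) + 1)
      fun ys => ys.length ≤ xs.length ∧ ∀ y ∈ ys, Q y := by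
  induction xs with
  | nil => exact (tick_pure (by simp)).le (by simp)
  | cons x xs ih =>
    have ih' := ih fun z hz => hf z (by simp [hz])
    refine le (tick_bind <| (hf x (by simp)).bind
      -- The last `+ 1` pays for the list cell of a kept element; the other branch is padded to the
      -- same bound.
      (t' := xs.length * (t + 2) + 1 + 1) fun o ho => ?_) ?_
    · cases o with
      | none => exact ih'.mono (by omega) fun ys hys => ⟨by simp; omega, hys.2⟩
      | some y =>
        refine ih'.bind fun ys hys => alloc_pure ?_
        simpa using ⟨hys.1, ho y rfl, hys.2⟩
    · simp only [List.length_cons, Nat.succ_mul]; omega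

/-- A pair pays 4 besides `t`: 2 in `mapC` and 2 when `appendC` copies its row. Only the new row is
copied, never the accumulated rest, so the cost stays proportional to the number of pairs. -/
theorem prodC {f : α → β → Comp γ} {t : ℕ} {Q : γ → Prop} {xs : List α} {ys : List β}
    (hf : ∀ x ∈ xs, ∀ y ∈ ys, Within (f x y) t Q) :
    Within (prodC f xs ys) (xs.length * (ys.length * (t + 4) + 3) + 1)
      fun zs => zs.length = xs.length * ys.length ∧ ∀ z ∈ zs, Q z := by
  induction xs with
  | nil => exact (tick_pure (by simp)).le (by simp)
  | cons x xs ih =>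
    refine le (tick_bind <| (mapC (hf x (by simp))).bind fun zs hzs =>
      (ih fun z hz => hf z (by simp [hz])).bind fun rest hr =>
        ((appendC zs rest).mono (t' := 2 * ys.length + 1) (by omega) ?_)) ?_
    · rintro _ rfl
      refine ⟨by simp [hzs.1, hr.1, Nat.succ_mul, Nat.add_comm], fun z hz => ?_⟩
      rcases List.mem_append.1 hz with h | h
      exacts [hzs.2 z h, hr.2 z h]
    · simp only [List.length_cons, Nat.succ_mul, Nat.mul_add]; omega

end Within

end Metered

/-! ### Size of the fair normal form and cost of its computation -/

/-- The number of nodes of a propositional formula. -/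
def PForm.size {AP : Type} : PForm AP → ℕ
  | tt => 1
  | ff => 1
  | pos _ => 1
  | neg _ => 1
  | and p q => p.size + q.size + 1
  | or p q => p.size + q.size + 1

/-- The number of cells that hold a disjunct. -/
def Disjunct.weight {AP : Type} (d : Disjunct AP) : ℕ :=
  d.always.size + (d.often.map fun l => l.size + 1).sum

section Flatten

variable {AP : Type}

theorem Formula.size_pos (φ : Formula AP) : 0 < φ.size := by
  cases φ <;> simp [Formula.size]

theorem Disjunct.length_often_le_weight (d : Disjunct AP) : d.often.length ≤ d.weight := by
  have : d.often.length ≤ (d.often.map fun l => l.size + 1).sum := by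
    induction d.often with
    | nil => simp
    | cons l ls ih => simp only [List.length_cons, List.map_cons, List.sum_cons]; omega
  unfold Disjunct.weight; omega

theorem within_negC (φ : Formula AP) :
    Within (negC φ) φ.size fun ψ => ψ.size = φ.size := by
  induction φ with
  | pos a => exact Within.alloc_pure rfl
  | neg a => exact Within.alloc_pure rfl
  | and φ ψ ihφ ihψ =>
    exact (ihφ.bind fun x hx => ihψ.bind fun y hy =>
      Within.alloc_pure (by simp [Formula.size, hx, hy])).le (by simp only [Formula.size]; omega)
  | or φ ψ ihφ ihψ =>
    exact (ihφ.bind fun x hx => ihψ.bind fun y hy =>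
      Within.alloc_pure (by simp [Formula.size, hx, hy])).le (by simp only [Formula.size]; omega)
  | ev φ ih => exact ih.bind fun x hx => Within.alloc_pure (by simp [Formula.size, hx])
  | alw φ ih => exact ih.bind fun x hx => Within.alloc_pure (by simp [Formula.size, hx])

theorem within_toPropC (φ : Formula AP) :
    Within (toPropC φ) (2 * φ.size) fun o => ∀ p ∈ o, p.size = φ.size := by
  induction φ with
  | pos a => exact (Within.alloc_pure (by simp [PForm.size, Formula.size])).le (by simp [Formula.size])
  | neg a => exact (Within.alloc_pure (by simp [PForm.size, Formula.size])).le (by simp [Formula.size])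
  | and φ ψ ihφ ihψ =>
    refine (Within.tick_bind <| ihφ.bind fun x hx => ihψ.bind (t' := 1) fun y hy => ?_).le
      (by simp only [Formula.size]; omega)
    cases x <;> cases y <;> first
      | exact Within.alloc_pure (by
          simp only [Option.mem_def, Option.some.injEq, forall_eq'] at hx hy ⊢
          simp [PForm.size, Formula.size, hx, hy])
      | exact (Within.pure (by simp)).le (by omega)
  | or φ ψ ihφ ihψ =>
    refine (Within.tick_bind <| ihφ.bind fun x hx => ihψ.bind (t' := 1) fun y hy => ?_).le
      (by simp only [Formula.size]; omega)
    cases x <;> cases y <;> first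
      | exact Within.alloc_pure (by
          simp only [Option.mem_def, Option.some.injEq, forall_eq'] at hx hy ⊢
          simp [PForm.size, Formula.size, hx, hy])
      | exact (Within.pure (by simp)).le (by omega)
  | ev φ ih => exact (Within.tick_pure (by simp)).le (by simp [Formula.size]; omega)
  | alw φ ih => exact (Within.tick_pure (by simp)).le (by simp [Formula.size]; omega)

theorem within_andC (p q : PForm AP) :
    Within (andC p q) 2 fun r => r.size ≤ p.size + q.size + 1 := by
  refine Within.tick_bind (t := 1) ?_
  cases p <;> cases q <;> first
    | exact Within.alloc_pure le_rfl
    | exact (Within.pure (by simp only [PForm.size]; omega)).le (by omega)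

theorem within_orC (p q : PForm AP) :
    Within (orC p q) 2 fun r => r.size ≤ p.size + q.size + 1 := by
  refine Within.tick_bind (t := 1) ?_
  cases p <;> cases q <;> first
    | exact Within.alloc_pure le_rfl
    | exact (Within.pure (by simp only [PForm.size]; omega)).le (by omega)

theorem within_oneC : Within (oneC (AP := AP)) 1 fun d => d.weight = 1 :=
  Within.alloc_pure rfl

/-- The cost involves `d` alone because appending copies the left list and shares the right one. -/
theorem within_mulC (d e : Disjunct AP) :
    Within (mulC d e) (2 * d.weight + 4) fun r => r.weight ≤ d.weight + e.weight + 1 := by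
  refine ((within_andC _ _).bind fun l hl => (Within.appendC _ _).bind fun ls hls =>
    Within.alloc_pure ?_).le ?_
  · subst hls
    simp only [Disjunct.weight, List.map_append, List.sum_append]
    omega
  · have := d.length_often_le_weight
    omega

theorem within_attachC (m : Mode) (x : PForm AP × Disjunct AP) :
    Within (attachC m x) 4 fun o => ∀ d ∈ o, d.weight ≤ x.1.size + x.2.weight + 1 := by
  obtain ⟨l, d⟩ := x
  -- All shapes of `l` other than the two constants run this same code, which is therefore analysed
  -- once.
  have key : Within (do
      tick
      match m with
      | .gf => do
        alloc 2
        return some (⟨d.always, l :: d.often⟩ : Disjunct AP)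
      | .fg => do
        let l' ← andC l d.always
        alloc 1
        return some ⟨l', d.often⟩) 4 fun o => ∀ e ∈ o, e.weight ≤ l.size + d.weight + 1 := by
    cases m with
    | gf =>
      refine (Within.tick_bind (Within.alloc_pure ?_)).le (by omega)
      simp only [Option.mem_def, Option.some.injEq, forall_eq', Disjunct.weight, List.map_cons,
        List.sum_cons]
      omega
    | fg =>
      refine (Within.tick_bind ((within_andC _ _).bind fun l' hl' => Within.alloc_pure ?_)).le
        (by omega)
      simp only [Option.mem_def, Option.some.injEq, forall_eq', Disjunct.weight]
      omega
  cases l with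
  | ff => exact (Within.tick_pure (by simp)).le (by omega)
  | tt => exact (Within.tick_pure (by simp; omega)).le (by omega)
  | _ => exact key

theorem within_attachAllC (m : Mode) {es : List (PForm AP × Disjunct AP)} {w : ℕ}
    (h : ∀ x ∈ es, x.1.size + x.2.weight ≤ w) :
    Within (attachAllC m es) (es.length * 6 + 1)
      fun ds => ds.length ≤ es.length ∧ ∀ d ∈ ds, d.weight ≤ w + 1 :=
  Within.filterMapC fun x hx => (within_attachC m x).mono le_rfl fun o ho d hd => by
    have := ho d hd
    have := h x hx
    omega

/-- The conclusions about a list of expanded formulas after a binary connective. -/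
theorem within_expandC_prod {op : PForm AP → PForm AP → Comp (PForm AP)}
    (hop : ∀ p q, Within (op p q) 2 fun r => r.size ≤ p.size + q.size + 1)
    {es fs : List (PForm AP × Disjunct AP)} {v w : ℕ}
    (hes : ∀ x ∈ es, x.1.size + x.2.weight ≤ v) (hfs : ∀ x ∈ fs, x.1.size + x.2.weight ≤ w) :
    Within (prodC (fun x y => do
      let l ← op x.1 y.1
      let d ← mulC x.2 y.2
      alloc 1
      return (l, d)) es fs) (es.length * (fs.length * (2 * v + 11) + 3) + 1)
      fun zs => zs.length = es.length * fs.length ∧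
        ∀ z ∈ zs, z.1.size + z.2.weight ≤ v + w + 2 := by
  -- A pair costs at most `2 * v + 7`: 2 for `op`, `2 * v + 4` for `mulC`, and 1 for the pair
  -- itself.
  refine Within.prodC fun x hx y hy => ?_
  have h1 := hes x hx
  have h2 := hfs y hy
  refine ((hop _ _).bind fun l hl => (within_mulC _ _).bind fun d hd =>
    Within.alloc_pure ?_).le (by omega)
  show l.size + d.weight ≤ _
  omega

-- Growth of the bound on the number of disjuncts

/-- A bound for the number of disjuncts in the fair normal form of a formula of size `n`. -/
def countBound (n : ℕ) : ℕ := 3 ^ (n + 1) / 2 ^ (n + 1)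

/-- The shift by one in the exponent makes the connective itself account for the product, and a
product of integer parts is at most the integer part of the product. -/
theorem countBound_mul_le (a b : ℕ) :
    countBound a * countBound b ≤ countBound (a + b + 1) := by
  refine (Nat.div_mul_div_le _ _ _ _).trans (le_of_eq ?_)
  unfold countBound
  rw [← pow_add, ← pow_add]
  congr 2 <;> omega

theorem two_le_countBound {n : ℕ} (hn : 0 < n) : 2 ≤ countBound n := by
  unfold countBound
  rw [Nat.le_div_iff_mul_le (by positivity)]
  induction n, hn using Nat.le_induction with
  | base => norm_num
  | succ n hn ih => rw [pow_succ 2 (n + 1), pow_succ 3 (n + 1)]; omega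

/-- Multiplying a number that is at least 2 by `3/2` adds at least 1. -/
theorem countBound_succ_le {n : ℕ} (hn : 0 < n) : countBound n + 1 ≤ countBound (n + 1) := by
  have h := two_le_countBound hn
  have h1 : countBound n * 2 ^ (n + 1) ≤ 3 ^ (n + 1) := Nat.div_mul_le_self _ _
  have h2 : countBound (n + 1) = 3 ^ (n + 2) / 2 ^ (n + 2) := rfl
  rw [h2, Nat.le_div_iff_mul_le (by positivity), pow_succ, pow_succ 3]
  nlinarith [Nat.mul_le_mul_right (2 ^ (n + 1)) h]

theorem countBound_add_le {a b : ℕ} (ha : 0 < a) (hb : 0 < b) :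
    countBound a + countBound b ≤ countBound (a + b + 1) := by
  refine le_trans ?_ (countBound_mul_le a b)
  nlinarith [two_le_countBound ha, two_le_countBound hb]

/-- The quotient of the two sides behaves like `n ^ 2 * (3/4) ^ n`, which is bounded. -/
theorem sq_mul_countBound_le (n : ℕ) : n ^ 2 * countBound n ≤ 16 * 2 ^ n := by
  have key : ∀ n : ℕ, n ^ 2 * 3 ^ (n + 1) ≤ 16 * 2 ^ n * 2 ^ (n + 1) := by
    intro n
    by_cases hn : n ≤ 7
    · interval_cases n <;> norm_num
    -- 7 is the least positive `n` with `3 * (n + 1) ^ 2 ≤ 4 * n ^ 2`; from there on the quotient no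
    -- longer increases.
    · have h7 : 7 ≤ n := by omega
      induction n, h7 using Nat.le_induction with
      | base => norm_num
      | succ n h7 ih =>
        have ih' : n ^ 2 * 3 ^ (n + 1) ≤ 16 * 2 ^ n * 2 ^ (n + 1) := by
          by_cases h : n ≤ 7
          · obtain rfl : n = 7 := by omega
            norm_num
          · exact ih h
        have h3 : 3 * (n + 1) ^ 2 ≤ 4 * n ^ 2 := by nlinarith
        calc (n + 1) ^ 2 * 3 ^ (n + 1 + 1) = 3 * (n + 1) ^ 2 * 3 ^ (n + 1) := by ring
          _ ≤ 4 * n ^ 2 * 3 ^ (n + 1) := Nat.mul_le_mul_right _ h3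
          _ = 4 * (n ^ 2 * 3 ^ (n + 1)) := by ring
          _ ≤ 4 * (16 * 2 ^ n * 2 ^ (n + 1)) := by omega
          _ = _ := by ring
  have h1 : countBound n * 2 ^ (n + 1) ≤ 3 ^ (n + 1) := Nat.div_mul_le_self _ _
  refine Nat.le_of_mul_le_mul_right (c := 2 ^ (n + 1)) ?_ (by positivity)
  calc n ^ 2 * countBound n * 2 ^ (n + 1) = n ^ 2 * (countBound n * 2 ^ (n + 1)) := by ring
    _ ≤ n ^ 2 * 3 ^ (n + 1) := Nat.mul_le_mul_left _ h1
    _ ≤ _ := key n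

end Flatten

end FairLTL

namespace FairLTL

-- Induction over the formula: size and cost of the normal form

section FlattenBounds

variable {AP : Type}

/-- A bound for the cost of computing the fair normal form of a formula of size `n`. -/
def flattenBound (n : ℕ) : ℕ := 40 * (n ^ 2 * countBound n)

/-- Since `a ^ 2 + b ^ 2 + (a + b + 1) ≤ (a + b + 1) ^ 2`, the quadratic factor leaves room at every
binary node for work linear in the size times the number of disjuncts. -/
theorem flattenBound_add_le {a b : ℕ} (ha : 0 < a) (hb : 0 < b) :
    flattenBound a + flattenBound b + 40 * ((a + b + 1) * countBound (a + b + 1)) ≤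
      flattenBound (a + b + 1) := by
  have h := countBound_add_le ha hb
  unfold flattenBound
  have h1 : a ^ 2 * countBound a ≤ a ^ 2 * countBound (a + b + 1) :=
    Nat.mul_le_mul_left _ (by omega)
  have h2 : b ^ 2 * countBound b ≤ b ^ 2 * countBound (a + b + 1) :=
    Nat.mul_le_mul_left _ (by omega)
  have h3 : (a ^ 2 + b ^ 2 + (a + b + 1)) * countBound (a + b + 1) ≤
      (a + b + 1) ^ 2 * countBound (a + b + 1) := Nat.mul_le_mul_right _ (by nlinarith)
  simp only [Nat.add_mul] at h3 ⊢
  omega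

theorem flattenBound_succ_le {n : ℕ} (hn : 0 < n) :
    flattenBound n + 40 * countBound n ≤ flattenBound (n + 1) := by
  have h := countBound_succ_le hn
  unfold flattenBound
  have h3 : (n ^ 2 + 1) * countBound n ≤ (n + 1) ^ 2 * countBound (n + 1) :=
    Nat.mul_le_mul (by nlinarith) (by omega)
  simp only [Nat.add_mul, one_mul] at h3 ⊢
  omega

theorem le_flattenBound {n : ℕ} (hn : 0 < n) : 80 * n ≤ flattenBound n := by
  have h := two_le_countBound hn
  unfold flattenBound
  have : n * 2 ≤ n ^ 2 * countBound n := Nat.mul_le_mul (Nat.le_self_pow two_ne_zero n) h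
  omega

/-- The left side is the cost of `prodC` when the left entries weigh at most `4 * a`. There are at
most `countBound (a + b + 1)` pairs, each of linear cost, and the terms `3 * x + 1` are absorbed. -/
theorem prod_cost_le {a b x y : ℕ} (ha : 0 < a) (hb : 0 < b) (hx : x ≤ countBound a)
    (hy : y ≤ countBound b) :
    x * (y * (2 * (4 * a) + 11) + 3) + 1 ≤ 24 * ((a + b + 1) * countBound (a + b + 1)) := by
  have h1 : x * y ≤ countBound (a + b + 1) :=
    (Nat.mul_le_mul hx hy).trans (countBound_mul_le a b)
  have h2 := countBound_add_le ha hb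
  have h3 := two_le_countBound ha
  calc x * (y * (2 * (4 * a) + 11) + 3) + 1 = x * y * (8 * a + 11) + 3 * x + 1 := by ring
    _ ≤ countBound (a + b + 1) * (8 * a + 11) + 3 * countBound (a + b + 1) +
        countBound (a + b + 1) := by
        have := Nat.mul_le_mul_right (8 * a + 11) h1
        omega
    _ = countBound (a + b + 1) * (8 * a + 15) := by ring
    _ ≤ countBound (a + b + 1) * (24 * (a + b + 1)) := Nat.mul_le_mul_left _ (by omega)
    _ = _ := by ring

/-- The result of `flatC` on a formula of size `n` is small and computed fast. -/
def FlatWithin (c : Comp (List (Disjunct AP))) (n : ℕ) : Prop :=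
  Within c (flattenBound n) fun ds =>
    ds.length ≤ countBound n ∧ ∀ d ∈ ds, d.weight ≤ 4 * n

/-- The result of `expandC` on a formula of size `n` is small and computed fast. -/
def ExpandWithin (c : Comp (List (PForm AP × Disjunct AP))) (n : ℕ) : Prop :=
  Within c (flattenBound n) fun es =>
    es.length ≤ countBound n ∧ ∀ x ∈ es, x.1.size + x.2.weight ≤ 4 * n

theorem within_attachAllC_one (m : Mode) (p : PForm AP) {n : ℕ} (hn : 0 < n) (hp : p.size = n) :
    Within (do
      let d ← oneC
      alloc 2
      attachAllC m [(p, d)]) 10 fun ds =>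
        ds.length ≤ countBound n ∧ ∀ d ∈ ds, d.weight ≤ 4 * n := by
  have h := two_le_countBound hn
  refine within_oneC.bind fun d hd => Within.alloc_bind (f := fun _ => attachAllC m [(p, d)])
    ((within_attachAllC m (w := n + 1) ?_).mono (t' := 7) (by simp) ?_)
  · simp [hp, hd]
  · rintro ds ⟨h1, h2⟩
    simp only [List.length_singleton] at h1
    exact ⟨by omega, fun d hd => (h2 d hd).trans (by omega)⟩

theorem flatWithin_lit (m : Mode) (p : PForm AP) (hp : p.size = 1) :
    FlatWithin (do
      tick
      alloc 1
      let d ← oneC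
      alloc 2
      attachAllC m [(p, d)]) 1 :=
  (Within.tick_bind <| Within.alloc_bind <| within_attachAllC_one m p one_pos hp).le
    (le_trans (by norm_num) (le_flattenBound one_pos))

theorem expandWithin_lit (p : PForm AP) (hp : p.size = 1) :
    ExpandWithin (do
      tick
      alloc 1
      let d ← oneC
      alloc 2
      return [(p, d)]) 1 := by
  have h := two_le_countBound one_pos
  refine (Within.tick_bind <| Within.alloc_bind <| within_oneC.bind fun d hd =>
    Within.alloc_pure ?_).le (le_trans (by norm_num) (le_flattenBound one_pos))
  simp [hp, hd]
  omega

theorem expandWithin_modal {c : Comp (List (Disjunct AP))} {n : ℕ} (hn : 0 < n)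
    (hc : FlatWithin c n) :
    ExpandWithin (do
      tick
      let ds ← c
      let xs ← mapC (fun d => do
        alloc 1
        return (PForm.tt, d)) ds
      let d ← oneC
      alloc 2
      return (.ff, d) :: xs) (n + 1) := by
  have h := countBound_succ_le hn
  have h2 := two_le_countBound hn
  have h3 := flattenBound_succ_le hn
  refine (Within.tick_bind <| hc.bind fun ds hds =>
    ((Within.mapC (t := 1) (Q := fun x => x.1.size + x.2.weight ≤ 4 * (n + 1))
      fun d hd => Within.alloc_pure ?_).le (t' := 3 * countBound n + 1) (by omega)).bind
        fun xs hxs => within_oneC.bind fun d hd => Within.alloc_pure ?_).le (by omega)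
  · have := hds.2 d hd
    simp only [PForm.size]
    omega
  · refine ⟨by simp only [List.length_cons]; omega, fun x hx => ?_⟩
    rcases List.mem_cons.1 hx with rfl | hx
    · simp only [PForm.size, hd]
      omega
    · exact hxs.2 x hx

theorem within_expand_expand {op : PForm AP → PForm AP → Comp (PForm AP)}
    (hop : ∀ p q, Within (op p q) 2 fun r => r.size ≤ p.size + q.size + 1)
    {c c' : Comp (List (PForm AP × Disjunct AP))} {a b : ℕ} (ha : 0 < a) (hb : 0 < b)
    (hc : ExpandWithin c a) (hc' : ExpandWithin c' b) :
    Within (do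
      let xs ← c
      let ys ← c'
      prodC (fun x y => do
        let l ← op x.1 y.1
        let d ← mulC x.2 y.2
        alloc 1
        return (l, d)) xs ys)
      (flattenBound a + (flattenBound b + 24 * ((a + b + 1) * countBound (a + b + 1))))
      fun es => es.length ≤ countBound (a + b + 1) ∧
        ∀ x ∈ es, x.1.size + x.2.weight ≤ 4 * a + 4 * b + 2 := by
  refine hc.bind fun xs hxs => hc'.bind fun ys hys =>
    (within_expandC_prod hop hxs.2 hys.2).mono (prod_cost_le ha hb hxs.1 hys.1) ?_
  rintro zs ⟨h1, h2⟩
  exact ⟨h1.trans_le ((Nat.mul_le_mul hxs.1 hys.1).trans (countBound_mul_le a b)), h2⟩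

theorem expandWithin_binary {op : PForm AP → PForm AP → Comp (PForm AP)}
    (hop : ∀ p q, Within (op p q) 2 fun r => r.size ≤ p.size + q.size + 1)
    {c c' : Comp (List (PForm AP × Disjunct AP))} {a b : ℕ} (ha : 0 < a) (hb : 0 < b)
    (hc : ExpandWithin c a) (hc' : ExpandWithin c' b) :
    ExpandWithin (do
      tick
      let xs ← c
      let ys ← c'
      prodC (fun x y => do
        let l ← op x.1 y.1
        let d ← mulC x.2 y.2
        alloc 1
        return (l, d)) xs ys) (a + b + 1) := by
  have h1 := flattenBound_add_le ha hb
  have h2 : 1 * 2 ≤ (a + b + 1) * countBound (a + b + 1) :=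
    Nat.mul_le_mul (by omega) (two_le_countBound (by omega))
  refine (Within.tick_bind (within_expand_expand hop ha hb hc hc')).mono (by omega) ?_
  rintro es ⟨h3, h4⟩
  exact ⟨h3, fun x hx => (h4 x hx).trans (by omega)⟩

theorem within_flat_expand {op : PForm AP → PForm AP → Comp (PForm AP)}
    (hop : ∀ p q, Within (op p q) 2 fun r => r.size ≤ p.size + q.size + 1) (m : Mode)
    {c c' : Comp (List (PForm AP × Disjunct AP))} {a b : ℕ} (ha : 0 < a) (hb : 0 < b)
    (hc : ExpandWithin c a) (hc' : ExpandWithin c' b) :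
    Within (do
      let xs ← c
      let ys ← c'
      let zs ← prodC (fun x y => do
        let l ← op x.1 y.1
        let d ← mulC x.2 y.2
        alloc 1
        return (l, d)) xs ys
      attachAllC m zs)
      (flattenBound a + flattenBound b + 31 * ((a + b + 1) * countBound (a + b + 1)))
      fun ds => ds.length ≤ countBound (a + b + 1) ∧
        ∀ d ∈ ds, d.weight ≤ 4 * (a + b + 1) := by
  have h0 := two_le_countBound (n := a + b + 1) (by omega)
  have h2 : 1 * countBound (a + b + 1) ≤ (a + b + 1) * countBound (a + b + 1) :=
    Nat.mul_le_mul_right _ (by omega)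
  -- The product takes 24 of the 31 units and `attachAllC` at most 7. Weights reach `4 * a + 4 * b +
  -- 2` in the product and grow by 1 here, still below `4 * (a + b + 1)`.
  have key := (within_expand_expand hop ha hb hc hc').bind fun zs hzs =>
    (within_attachAllC m hzs.2).mono (t' := 6 * countBound (a + b + 1) + 1)
      (by have := hzs.1; omega) (Q' := fun ds => ds.length ≤ countBound (a + b + 1) ∧
        ∀ d ∈ ds, d.weight ≤ 4 * (a + b + 1))
      fun ds hds => ⟨hds.1.trans hzs.1, fun d hd => (hds.2 d hd).trans (by omega)⟩
  exact key.le (by omega)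

theorem within_flat_mul {c c' : Comp (List (Disjunct AP))} {a b : ℕ} (ha : 0 < a) (hb : 0 < b)
    (hc : FlatWithin c a) (hc' : FlatWithin c' b) :
    Within (do
      let ds ← c
      let es ← c'
      prodC mulC ds es)
      (flattenBound a + flattenBound b + 31 * ((a + b + 1) * countBound (a + b + 1)))
      fun ds => ds.length ≤ countBound (a + b + 1) ∧
        ∀ d ∈ ds, d.weight ≤ 4 * (a + b + 1) := by
  refine (hc.bind fun xs hxs => hc'.bind fun ys hys =>
    -- `mulC` needs only `2 * (4 * a) + 4`; the padding lets `prod_cost_le` apply as in the other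
    -- product.
    (Within.prodC (t := 2 * (4 * a) + 7) (Q := fun d => d.weight ≤ 4 * (a + b + 1))
      fun d hd e he => ?_).mono (prod_cost_le ha hb hxs.1 hys.1) ?_).le (by omega)
  · have h1 := hxs.2 d hd
    have h2 := hys.2 e he
    exact (within_mulC d e).mono (by omega) fun r hr => by omega
  · rintro zs ⟨h1, h2⟩
    exact ⟨h1.trans_le ((Nat.mul_le_mul hxs.1 hys.1).trans (countBound_mul_le a b)), h2⟩

theorem within_flat_append {c c' : Comp (List (Disjunct AP))} {a b : ℕ} (ha : 0 < a) (hb : 0 < b)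
    (hc : FlatWithin c a) (hc' : FlatWithin c' b) :
    Within (do
      let ds ← c
      let es ← c'
      appendC ds es)
      (flattenBound a + flattenBound b + 31 * ((a + b + 1) * countBound (a + b + 1)))
      fun ds => ds.length ≤ countBound (a + b + 1) ∧
        ∀ d ∈ ds, d.weight ≤ 4 * (a + b + 1) := by
  have h0 := countBound_add_le ha hb
  have h1 := two_le_countBound ha
  have h2 : 1 * countBound (a + b + 1) ≤ (a + b + 1) * countBound (a + b + 1) :=
    Nat.mul_le_mul_right _ (by omega)
  refine (hc.bind fun xs hxs => hc'.bind fun ys hys =>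
    (Within.appendC xs ys).mono (t' := 2 * countBound a + 1) (by omega) ?_).le (by omega)
  rintro _ rfl
  refine ⟨by simp only [List.length_append]; omega, fun d hd => ?_⟩
  rcases List.mem_append.1 hd with hd | hd
  · exact (hxs.2 d hd).trans (by omega)
  · exact (hys.2 d hd).trans (by omega)

theorem flatWithin_binary {φ : Formula AP} {a b : ℕ} (ha : 0 < a) (hb : 0 < b)
    (hφ : φ.size = a + b + 1) (m : Mode) {c : Comp (List (Disjunct AP))}
    (hc : Within c
      (flattenBound a + flattenBound b + 31 * ((a + b + 1) * countBound (a + b + 1)))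
      fun ds => ds.length ≤ countBound (a + b + 1) ∧ ∀ d ∈ ds, d.weight ≤ 4 * (a + b + 1)) :
    FlatWithin (do
      tick
      match ← toPropC φ with
      | some p => do
        let d ← oneC
        alloc 2
        attachAllC m [(p, d)]
      | none => c) (a + b + 1) := by
  have h1 := flattenBound_add_le ha hb
  have h2 : (a + b + 1) * 2 ≤ (a + b + 1) * countBound (a + b + 1) :=
    Nat.mul_le_mul_left _ (two_le_countBound (by omega))
  -- Covers the 10 steps of the branch where the formula is propositional.
  have h3 := le_flattenBound ha
  refine (Within.tick_bind <| (within_toPropC φ).bind fun o ho => ?_).le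
    (t := 1 + (2 * φ.size + (flattenBound a + flattenBound b +
      31 * ((a + b + 1) * countBound (a + b + 1))))) (by omega)
  cases o with
  | none => exact hc
  | some p => exact (within_attachAllC_one m p (by omega) ((ho p rfl).trans hφ)).le (by omega)

/-- The two functions call each other only on immediate subformulas, so proving both bounds together
turns the mutual recursion into structural induction. The mode is quantified because the modalities
change it. -/
theorem flatWithin_and_expandWithin (φ : Formula AP) :
    (∀ m, FlatWithin (flatC φ m) φ.size) ∧ ExpandWithin (expandC φ) φ.size := by
  induction φ with
  | pos a =>
    simp only [flatC, expandC]
    exact ⟨fun m => flatWithin_lit m _ rfl, expandWithin_lit _ rfl⟩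
  | neg a =>
    simp only [flatC, expandC]
    exact ⟨fun m => flatWithin_lit m _ rfl, expandWithin_lit _ rfl⟩
  | and φ ψ ihφ ihψ =>
    refine ⟨fun m => ?_, ?_⟩
    · cases m <;> simp only [flatC]
      · exact flatWithin_binary φ.size_pos ψ.size_pos rfl .gf
          (within_flat_expand within_andC .gf φ.size_pos ψ.size_pos ihφ.2 ihψ.2)
      · exact flatWithin_binary φ.size_pos ψ.size_pos rfl .fg
          (within_flat_mul φ.size_pos ψ.size_pos (ihφ.1 _) (ihψ.1 _))
    · simp only [expandC]
      exact expandWithin_binary within_andC φ.size_pos ψ.size_pos ihφ.2 ihψ.2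
  | or φ ψ ihφ ihψ =>
    refine ⟨fun m => ?_, ?_⟩
    · cases m <;> simp only [flatC]
      · exact flatWithin_binary φ.size_pos ψ.size_pos rfl .gf
          (within_flat_append φ.size_pos ψ.size_pos (ihφ.1 _) (ihψ.1 _))
      · exact flatWithin_binary φ.size_pos ψ.size_pos rfl .fg
          (within_flat_expand within_orC .fg φ.size_pos ψ.size_pos ihφ.2 ihψ.2)
    · simp only [expandC]
      exact expandWithin_binary within_orC φ.size_pos ψ.size_pos ihφ.2 ihψ.2
  | ev φ ih =>
    have h := countBound_succ_le φ.size_pos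
    have h3 := flattenBound_succ_le φ.size_pos
    have h2 := two_le_countBound φ.size_pos
    simp only [flatC, expandC]
    refine ⟨fun m => (Within.tick_bind (f := fun _ => flatC φ .gf) (ih.1 .gf)).mono ?_ fun ds hds => ?_,
      expandWithin_modal φ.size_pos (ih.1 _)⟩
    · simp only [Formula.size]
      omega
    · simp only [Formula.size]
      exact ⟨by omega, fun d hd => (hds.2 d hd).trans (by omega)⟩
  | alw φ ih =>
    have h := countBound_succ_le φ.size_pos
    have h3 := flattenBound_succ_le φ.size_pos
    have h2 := two_le_countBound φ.size_pos
    simp only [flatC, expandC]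
    refine ⟨fun m => (Within.tick_bind (f := fun _ => flatC φ .fg) (ih.1 .fg)).mono ?_ fun ds hds => ?_,
      expandWithin_modal φ.size_pos (ih.1 _)⟩
    · simp only [Formula.size]
      omega
    · simp only [Formula.size]
      exact ⟨by omega, fun d hd => (hds.2 d hd).trans (by omega)⟩

end FlattenBounds

end FairLTL

namespace FairLTL

/-! ### Cost of the search for accepting components -/

/-- The computation makes at most `t` steps and leaves the memory unchanged. -/
def Quiet {α : Type} (c : Comp α) (t : ℕ) : Prop :=
  ∀ m, Wp c (fun _ m' => m'.time ≤ m.time + t ∧ m'.live = m.live ∧ m'.peak = m.peak) m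

namespace Quiet

variable {α β : Type}

theorem le {c : Comp α} {t t' : ℕ} (h : Quiet c t) (ht : t ≤ t') : Quiet c t' := fun m =>
  (h m).mono fun _ _ ⟨h1, h2⟩ => ⟨by omega, h2⟩

protected theorem pure (x : α) : Quiet (pure x) 0 := fun _ => wp_pure.2 ⟨le_rfl, rfl, rfl⟩

protected theorem bind {c : Comp α} {f : α → Comp β} {t t' : ℕ} (hc : Quiet c t)
    (hf : ∀ x, Quiet (f x) t') : Quiet (c >>= f) (t + t') := fun m =>
  wp_bind.2 <| (hc m).mono fun x m' ⟨h1, h2, h3⟩ => (hf x m').mono fun _ _ ⟨k1, k2, k3⟩ =>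
    ⟨by omega, by omega, by omega⟩

theorem tick_bind {f : Unit → Comp β} {t : ℕ} (h : Quiet (f ()) t) :
    Quiet (tick >>= f) (1 + t) := fun m =>
  wp_bind.2 <| wp_tick.2 <| (h _).mono fun _ _ ⟨k1, k2, k3⟩ => by
    dsimp only at k1 k2 k3
    exact ⟨by omega, k2, k3⟩

theorem tick_pure (x : α) : Quiet (tick >>= fun _ => pure x) 1 :=
  tick_bind (f := fun _ => pure x) (.pure x)

theorem ite {p : Prop} [Decidable p] {c c' : Comp α} {t : ℕ} (h : Quiet c t) (h' : Quiet c' t) :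
    Quiet (if p then c else c') t := by
  split <;> assumption

end Quiet

section Search

variable {AP S : Type} [DecidableEq AP]

theorem quiet_evalC (A : Finset AP) (p : PForm AP) : Quiet (evalC A p) p.size := by
  induction p with
  | and p q ihp ihq =>
    exact (Quiet.tick_bind <| ihp.bind fun _ => ihq.bind fun _ => .pure _).le
      (by simp only [PForm.size]; omega)
  | or p q ihp ihq =>
    exact (Quiet.tick_bind <| ihp.bind fun _ => ihq.bind fun _ => .pure _).le
      (by simp only [PForm.size]; omega)
  | _ => exact Quiet.tick_pure _

theorem quiet_memC [DecidableEq S] (s : S) (c : List S) : Quiet (memC s c) (c.length + 1) := by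
  induction c with
  | nil => exact Quiet.tick_pure _
  | cons t ts ih =>
    exact (Quiet.tick_bind <| Quiet.ite ((Quiet.pure _).le (Nat.zero_le _)) ih).le
      (by simp only [List.length_cons]; omega)

theorem quiet_existsC (label : S → Finset AP) (l : PForm AP) (c : List S) :
    Quiet (existsC label l c) (c.length * (l.size + 1) + 1) := by
  induction c with
  | nil => exact (Quiet.tick_pure _).le (by omega)
  | cons t ts ih =>
    exact (Quiet.tick_bind <| (quiet_evalC _ l).bind fun _ =>
      Quiet.ite ((Quiet.pure _).le (Nat.zero_le _)) ih).le
      (by simp only [List.length_cons, Nat.succ_mul]; omega)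

theorem quiet_allOftenC (label : S → Finset AP) (c : List S) (ls : List (PForm AP)) :
    Quiet (allOftenC label c ls) ((c.length + 2) * (ls.map fun l => l.size + 1).sum + 1) := by
  induction ls with
  | nil => exact (Quiet.tick_pure _).le (by omega)
  | cons l ls ih =>
    refine (Quiet.tick_bind <| (quiet_existsC label l c).bind fun _ =>
      Quiet.ite ih ((Quiet.pure _).le (Nat.zero_le _))).le ?_
    simp only [List.map_cons, List.sum_cons, Nat.mul_add, Nat.add_mul]
    omega

/-- The self-loop test scans one adjacency list. Charging it to the degrees in `c` makes the cost
additive over disjoint components. -/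
theorem quiet_nontrivialC [DecidableEq S] (adj : S → List S) (c : List S) :
    Quiet (nontrivialC adj c) ((c.map fun s => (adj s).length).sum + 2) := by
  match c with
  | [] => exact (Quiet.tick_pure _).le (by omega)
  | [s] =>
    exact Quiet.le (Quiet.tick_bind (f := fun _ => memC s (adj s)) (quiet_memC s _))
      (by simp only [List.map_cons, List.map_nil, List.sum_cons, List.sum_nil]; omega)
  | _ :: _ :: _ => exact (Quiet.tick_pure _).le (by omega)

theorem quiet_acceptingC [DecidableEq S] (label : S → Finset AP) (adj : S → List S)
    (d : Disjunct AP) (c : List S) :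
    Quiet (acceptingC label adj d c)
      ((c.map fun s => (adj s).length).sum + (c.length + 2) * d.weight + 3) := by
  have h : (c.length + 2) * (d.often.map fun l => l.size + 1).sum ≤ (c.length + 2) * d.weight :=
    Nat.mul_le_mul_left _ (Nat.le_add_left _ _)
  exact ((quiet_nontrivialC adj c).bind fun _ =>
    Quiet.ite (quiet_allOftenC label c d.often) ((Quiet.pure _).le (Nat.zero_le _))).le (by omega)

theorem quiet_satSetC [DecidableEq S] (label : S → Finset AP) (reach : S → Bool) (l : PForm AP)
    (ss : List S) : Quiet (satSetC label reach l ss) (ss.length * (l.size + 1) + 1) := by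
  induction ss with
  | nil => exact (Quiet.tick_pure _).le (by omega)
  | cons s ss ih =>
    exact (Quiet.tick_bind <| ih.bind fun _ => Quiet.ite (t := l.size)
      ((quiet_evalC _ l).bind fun _ => .pure _) ((Quiet.pure _).le (Nat.zero_le _))).le
      (by simp only [List.length_cons, Nat.succ_mul]; omega)

theorem quiet_nonemptyC (B : S → Bool) (ss : List S) :
    Quiet (nonemptyC B ss) (ss.length + 1) := by
  induction ss with
  | nil => exact Quiet.tick_pure _
  | cons s ss ih =>
    exact (Quiet.tick_bind <| Quiet.ite ((Quiet.pure _).le (Nat.zero_le _)) ih).le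
      (by simp only [List.length_cons]; omega)

-- Amortised analysis of depth-first search

variable [Fintype S]

/-- The total weight of the unmarked states. -/
def unmarked (vis : S → Bool) (g : S → ℕ) : ℕ := ∑ s with vis s = false, g s

theorem unmarked_false (g : S → ℕ) : unmarked (fun _ => false) g = ∑ s, g s := by
  simp [unmarked]

theorem length_eq_of_sum_map_eq {c c' : List S} {vis vis' : S → Bool}
    (h : ∀ g : S → ℕ, (c'.map g).sum + unmarked vis' g = (c.map g).sum + unmarked vis g) :
    c'.length + unmarked vis' (fun _ => 1) = c.length + unmarked vis fun _ => 1 := by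
  simpa using h fun _ => 1

variable [DecidableEq S]

theorem sum_length_update_cons (adj : S → List S) (s t : S) :
    ∑ v, (Function.update adj s (t :: adj s) v).length = ∑ v, (adj v).length + 1 := by
  rw [← Finset.add_sum_erase _ _ (Finset.mem_univ s),
    ← Finset.add_sum_erase _ (fun v => (adj v).length) (Finset.mem_univ s),
    Finset.sum_congr rfl fun v hv => by rw [Function.update_of_ne (Finset.ne_of_mem_erase hv)]]
  simp only [Function.update_self, List.length_cons]
  omega

theorem within_adjC (es : List (S × S)) :
    Within (adjC es) (2 * es.length + 1) fun adj => ∑ v, (adj v).length = es.length := by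
  induction es with
  | nil => exact Within.tick_pure (by simp)
  | cons e es ih =>
    exact (Within.tick_bind <| ih.bind fun adj h => Within.alloc_pure
      (by rw [sum_length_update_cons, h, List.length_cons])).le
      (by simp only [List.length_cons]; omega)

theorem within_revAdjC (es : List (S × S)) :
    Within (revAdjC es) (2 * es.length + 1) fun adj => ∑ v, (adj v).length = es.length := by
  induction es with
  | nil => exact Within.tick_pure (by simp)
  | cons e es ih =>
    exact (Within.tick_bind <| ih.bind fun adj h => Within.alloc_pure
      (by rw [sum_length_update_cons, h, List.length_cons])).le
      (by simp only [List.length_cons]; omega)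

theorem unmarked_update (vis : S → Bool) (g : S → ℕ) {w : S} (h : vis w = false) :
    unmarked vis g = unmarked (Function.update vis w true) g + g w := by
  unfold unmarked
  rw [← Finset.sum_erase_add _ _ (show w ∈ Finset.univ.filter (fun s => vis s = false) by simp [h])]
  congr 2
  ext s
  by_cases hs : s = w
  · simp [hs]
  · simp [hs]

/-- States move from unmarked to the stack to the output, so any weight `g` is conserved in total;
`g` is left free so that counts and degrees follow from one invariant. For time, an unmarked state
holds a potential of its degree plus 4, and a stack entry its remaining list length plus 3. Leaving
the final potential on the left lets successive searches telescope. The hypothesis `hm` is needed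
because `free` subtracts with truncation: the popped cell must really be live. -/
theorem wp_dfsC (adj : S → List S) (B vis : S → Bool) (stack : List (S × List S)) (out : List S)
    (m : Meter) (hm : stack.length ≤ m.live) :
    Wp (dfsC adj B vis stack out) (fun r m' =>
      (∀ g : S → ℕ, (r.2.map g).sum + unmarked r.1 g =
        (out.map g).sum + (stack.map fun e => g e.1).sum + unmarked vis g) ∧
      m'.time + unmarked r.1 (fun s => (adj s).length + 4) ≤
        m.time + unmarked vis (fun s => (adj s).length + 4) +
          (stack.map fun e => e.2.length + 3).sum + 1 ∧
      m'.live + out.length + stack.length ≤ m.live + r.2.length ∧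
      m'.peak ≤ max m.peak (m.live + unmarked vis fun _ => 1)) m := by
  induction vis, stack, out using dfsC.induct adj B generalizing m with
  | case1 vis out =>
    rw [dfsC, wp_bind, wp_tick, wp_pure]
    exact ⟨fun g => by simp, by simp; omega, by simp, by simp⟩
  | case2 vis out v st ih =>
    rw [dfsC, wp_bind, wp_tick, wp_bind, wp_free, wp_bind, wp_alloc]
    simp only [List.length_cons] at hm
    refine (ih _ (by dsimp only; omega)).mono ?_
    rintro ⟨vis', out'⟩ m' ⟨h1, h2, h3, h4⟩
    simp only [List.map_cons, List.sum_cons, List.length_cons, List.length_nil] at *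
    exact ⟨fun g => by have := h1 g; omega, by omega, by omega, by omega⟩
  | case3 vis out v w ws st ih ih' =>
    rw [dfsC, wp_bind, wp_tick]
    simp only [List.length_cons] at hm
    split
    · next h =>
      rw [wp_bind, wp_alloc]
      refine (ih h _ (by simp only [List.length_cons]; omega)).mono ?_
      rintro ⟨vis', out'⟩ m' ⟨h1, h2, h3, h4⟩
      have hu := fun g => unmarked_update vis g h.2
      have hu1 := hu fun s => (adj s).length + 4
      have hu2 := hu fun _ => 1
      simp only [List.map_cons, List.sum_cons, List.length_cons] at *
      exact ⟨fun g => by have := h1 g; have := hu g; omega, by omega, by omega, by omega⟩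
    · refine (ih' _ (by simp only [List.length_cons]; omega)).mono ?_
      rintro ⟨vis', out'⟩ m' ⟨h1, h2, h3, h4⟩
      simp only [List.map_cons, List.sum_cons, List.length_cons] at *
      exact ⟨fun g => by have := h1 g; omega, by omega, by omega, by omega⟩

theorem wp_searchFromC (adj : S → List S) (B vis : S → Bool) {r : S} (hr : vis r = false)
    (out : List S) (m : Meter) :
    Wp (searchFromC adj B vis r out) (fun x m' =>
      (∀ g : S → ℕ, (x.2.map g).sum + unmarked x.1 g = (out.map g).sum + unmarked vis g) ∧
      m'.time + unmarked x.1 (fun s => (adj s).length + 4) ≤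
        m.time + unmarked vis (fun s => (adj s).length + 4) + 2 ∧
      m'.live + out.length ≤ m.live + x.2.length ∧
      m'.peak ≤ max m.peak (m.live + unmarked vis fun _ => 1)) m := by
  rw [searchFromC, wp_bind, wp_tick, wp_bind, wp_alloc]
  refine (wp_dfsC adj B _ _ _ _ (by simp)).mono ?_
  rintro ⟨vis', out'⟩ m' ⟨h1, h2, h3, h4⟩
  have hu := fun g => unmarked_update vis g hr
  have hu1 := hu fun s => (adj s).length + 4
  have hu2 := hu fun _ => 1
  simp only [List.map_cons, List.sum_cons, List.length_cons, List.map_nil, List.sum_nil,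
    List.length_nil] at *
  exact ⟨fun g => by have := h1 g; have := hu g; omega, by omega, by omega, by omega⟩

theorem wp_searchAllC (adj : S → List S) (B : S → Bool) (rs : List S) (vis : S → Bool)
    (out : List S) (m : Meter) :
    Wp (searchAllC adj B rs vis out) (fun out' m' =>
      out'.length ≤ out.length + unmarked vis (fun _ => 1) ∧
      m'.time ≤ m.time + unmarked vis (fun s => (adj s).length + 4) + 3 * rs.length + 1 ∧
      m'.live + out.length ≤ m.live + out'.length ∧
      m'.peak ≤ max m.peak (m.live + unmarked vis fun _ => 1)) m := by
  induction rs generalizing vis out m with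
  | nil =>
    rw [searchAllC, wp_bind, wp_tick, wp_pure]
    exact ⟨by simp, by simp, by simp, by simp⟩
  | cons r rs ih =>
    rw [searchAllC, wp_bind, wp_tick]
    split
    · next h =>
      rw [wp_bind]
      refine (wp_searchFromC adj B vis h.2 out _).mono ?_
      rintro ⟨vis', out'⟩ m' ⟨h1, h2, h3, h4⟩
      have h5 := length_eq_of_sum_map_eq h1
      refine (ih vis' out' m').mono ?_
      rintro out'' m'' ⟨k1, k2, k3, k4⟩
      simp only [List.length_cons] at *
      exact ⟨by omega, by omega, by omega, by omega⟩
    · refine (ih vis out _).mono ?_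
      rintro out'' m'' ⟨k1, k2, k3, k4⟩
      simp only [List.length_cons] at *
      exact ⟨by omega, by omega, by omega, by omega⟩

/-- Every component consists of states marked by its own search, so search, self-loop tests and
evaluations are paid from the unmarked states. Only the overhead `2 * d.weight + 6` is charged per
listed root. -/
theorem wp_componentsC (label : S → Finset AP) (adj radj : S → List S) (B : S → Bool)
    (d : Disjunct AP) (rs : List S) (vis : S → Bool) (m : Meter) :
    Wp (componentsC label adj radj B d rs vis) (fun _ m' =>
      m'.time ≤ m.time + unmarked vis (fun s => (radj s).length + 4) +
        unmarked vis (fun s => (adj s).length) + unmarked vis (fun _ => 1) * (d.weight + 1) +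
        rs.length * (2 * d.weight + 6) + 1 ∧
      m'.live ≤ m.live ∧
      m'.peak ≤ max m.peak (m.live + unmarked vis fun _ => 1)) m := by
  induction rs generalizing vis m with
  | nil =>
    rw [componentsC, wp_bind, wp_tick, wp_pure]
    exact ⟨by simp; omega, by simp, by simp⟩
  | cons r rs ih =>
    rw [componentsC, wp_bind, wp_tick]
    split
    · next h =>
      rw [wp_bind]
      refine (wp_searchFromC radj B vis h [] _).mono ?_
      rintro ⟨vis', c⟩ m1 ⟨h1, h2, h3, h4⟩
      have h5 := length_eq_of_sum_map_eq h1
      have h6 := h1 fun s => (adj s).length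
      -- The conservation of states multiplied by the cost per state, so that `omega` sees the
      -- products as atoms.
      have h7 := congrArg (· * (d.weight + 1)) h5
      rw [wp_bind]
      refine (quiet_acceptingC label adj d c m1).mono ?_
      rintro b m2 ⟨k1, k2, k3⟩
      rw [wp_bind, wp_free]
      simp only [List.length_cons, List.length_nil, List.map_nil, List.sum_nil, Nat.add_mul,
        Nat.mul_add, Nat.mul_one, Nat.one_mul, Nat.zero_add] at *
      split
      · rw [wp_pure]
        exact ⟨by dsimp only; omega, by dsimp only; omega, by dsimp only; omega⟩
      · refine (ih vis' _).mono ?_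
        rintro _ m3 ⟨l1, l2, l3⟩
        simp only at *
        exact ⟨by omega, by omega, by omega⟩
    · refine (ih vis _).mono ?_
      rintro _ m3 ⟨l1, l2, l3⟩
      simp only [List.length_cons, Nat.add_mul, Nat.one_mul] at *
      exact ⟨by omega, by omega, by omega⟩

-- The main loop and the whole procedure

theorem wp_checkC (label : S → Finset AP) {states : List S} (hs : states.length = Fintype.card S)
    {adj radj : S → List S} {E : ℕ} (hadj : ∑ s, (adj s).length = E)
    (hradj : ∑ s, (radj s).length = E) (reach : S → Bool) (d : Disjunct AP) (m : Meter) :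
    Wp (checkC label states adj radj reach d) (fun _ m' =>
      m'.time ≤ m.time + (Fintype.card S * (4 * d.weight + 28) + 3 * E + 4) ∧
      m'.live ≤ m.live ∧
      m'.peak ≤ max m.peak (m.live + 4 * Fintype.card S)) m := by
  have hw : states.length * (d.always.size + 1) ≤ states.length * (d.weight + 1) :=
    Nat.mul_le_mul_left _ (Nat.succ_le_succ (Nat.le_add_right _ _))
  have hu : unmarked (fun _ : S => false) (fun _ => 1) = states.length := by
    simp [unmarked_false, hs]
  have hua : unmarked (fun _ : S => false) (fun s => (adj s).length) = E := by
    rw [unmarked_false, hadj]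
  have hua4 : unmarked (fun _ : S => false) (fun s => (adj s).length + 4) =
      E + 4 * states.length := by
    simp [unmarked_false, Finset.sum_add_distrib, hadj, hs, mul_comm]
  have hur4 : unmarked (fun _ : S => false) (fun s => (radj s).length + 4) =
      E + 4 * states.length := by
    simp [unmarked_false, Finset.sum_add_distrib, hradj, hs, mul_comm]
  rw [← hs]
  rw [checkC, wp_bind, wp_alloc, wp_bind]
  refine (quiet_satSetC label reach d.always states _).mono ?_
  rintro B m1 ⟨a1, a2, a3⟩
  rw [wp_bind]
  refine (quiet_nonemptyC B states _).mono ?_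
  rintro ne m2 ⟨b1, b2, b3⟩
  split
  · rw [wp_bind, wp_alloc, wp_bind]
    refine (wp_searchAllC adj B states _ _ _).mono ?_
    rintro order m3 ⟨c0, c1, c2, c3⟩
    rw [wp_bind, wp_free, wp_bind, wp_alloc, wp_bind]
    refine (wp_componentsC label adj radj B d order _ _).mono ?_
    rintro b m4 ⟨d1, d2, d3⟩
    rw [wp_bind, wp_free, wp_bind, wp_free, wp_bind, wp_free, wp_pure]
    simp only [hu, hua, hua4, hur4, List.length_nil] at *
    -- The finishing order has at most `|S|` entries. The four blocks of `|S|` cells in the peak are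
    -- `B`, the array of marks, this list, and the component being collected.
    have ho : order.length * (2 * d.weight + 6) ≤ states.length * (2 * d.weight + 6) :=
      Nat.mul_le_mul_right _ (by omega)
    rw [show states.length * (2 * d.weight + 6) =
      2 * (states.length * d.weight) + 6 * states.length by ring] at ho
    rw [show states.length * (4 * d.weight + 28) =
      4 * (states.length * d.weight) + 28 * states.length by ring]
    simp only [Nat.mul_add, Nat.mul_one] at hw a1 d1
    simp only [Nat.mul_add] at ho
    exact ⟨by omega, by omega, by omega⟩
  · rw [wp_bind, wp_free, wp_pure]
    rw [show states.length * (4 * d.weight + 28) =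
      4 * (states.length * d.weight) + 28 * states.length by ring]
    simp only [Nat.mul_add, Nat.mul_one] at *
    exact ⟨by omega, by omega, by omega⟩

/-- Each round ends with no more live cells than it began with, so the peak does not depend on the
number of disjuncts. -/
theorem wp_loopC (label : S → Finset AP) {states : List S} (hs : states.length = Fintype.card S)
    {adj radj : S → List S} {E : ℕ} (hadj : ∑ s, (adj s).length = E)
    (hradj : ∑ s, (radj s).length = E) (reach : S → Bool) {w : ℕ} (ds : List (Disjunct AP))
    (hds : ∀ d ∈ ds, d.weight ≤ w) (m : Meter) :
    Wp (loopC label states adj radj reach ds) (fun _ m' =>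
      m'.time ≤ m.time + ds.length * (Fintype.card S * (4 * w + 28) + 3 * E + 5) + 1 ∧
      m'.live ≤ m.live ∧
      m'.peak ≤ max m.peak (m.live + 4 * Fintype.card S)) m := by
  induction ds generalizing m with
  | nil =>
    rw [loopC, wp_bind, wp_tick, wp_pure]
    exact ⟨by simp, by simp, by simp⟩
  | cons d ds ih =>
    have hd : Fintype.card S * (4 * d.weight + 28) ≤ Fintype.card S * (4 * w + 28) :=
      Nat.mul_le_mul_left _ (by have := hds d (by simp); omega)
    rw [loopC, wp_bind, wp_tick, wp_bind]
    refine (wp_checkC label hs hadj hradj reach d _).mono ?_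
    rintro b m1 ⟨h1, h2, h3⟩
    simp only [List.length_cons, Nat.succ_mul] at *
    split
    · rw [wp_pure]
      exact ⟨by omega, by omega, by omega⟩
    · refine (ih (fun e he => hds e (by simp [he])) m1).mono ?_
      rintro _ m2 ⟨k1, k2, k3⟩
      exact ⟨by omega, by omega, by omega⟩

theorem wp_fairMCListC {states : List S} (hs : states.length = Fintype.card S)
    (edges : List (S × S)) (label : S → Finset AP) (init : S) (φ : Formula AP) (m : Meter) :
    Wp (fairMCListC states edges label init φ) (fun _ m' =>
      m'.time ≤ m.time + (φ.size + flattenBound φ.size) +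
        countBound φ.size *
          (Fintype.card S * (16 * φ.size + 28) + 3 * edges.length + 5) +
        8 * Fintype.card S + 5 * edges.length + 5 ∧
      m'.peak ≤ max m.peak (m.live + (φ.size + flattenBound φ.size) + 7 * Fintype.card S +
        4 * edges.length + 2)) m := by
  rw [fairMCListC, wp_bind]
  refine (within_negC φ m).mono ?_
  rintro ψ m1 ⟨a1, a2, a3, a4⟩
  rw [wp_bind]
  refine ((flatWithin_and_expandWithin ψ).1 .gf m1).mono ?_
  rintro ds m2 ⟨b1, b2, b3, b4, b5⟩
  rw [a4] at b1 b2 b3 b4 b5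
  rw [wp_bind, wp_alloc, wp_bind]
  refine (within_adjC edges _).mono ?_
  rintro adj m3 ⟨c1, c2, c3, c4⟩
  rw [wp_bind, wp_alloc, wp_bind]
  refine (within_revAdjC edges _).mono ?_
  rintro radj m4 ⟨d1, d2, d3, d4⟩
  rw [wp_bind, wp_alloc, wp_bind]
  refine (wp_searchFromC adj _ _ rfl [] _).mono ?_
  rintro ⟨reach, out⟩ m5 ⟨e1, e2, e3, e4⟩
  have e5 := length_eq_of_sum_map_eq e1
  have hu : unmarked (fun _ : S => false) (fun _ => 1) = Fintype.card S := by
    simp [unmarked_false]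
  have hua4 : unmarked (fun _ : S => false) (fun s => (adj s).length + 4) =
      edges.length + 4 * Fintype.card S := by
    simp [unmarked_false, Finset.sum_add_distrib, c4, mul_comm]
  rw [wp_bind, wp_free]
  refine (wp_loopC label hs c4 d4 reach ds b5 _).mono ?_
  rintro _ m6 ⟨f1, f2, f3⟩
  -- Replaces the actual number of disjuncts by its bound; `16` comes from the factor 4 per unit of
  -- weight and the weight bound `4 * φ.size`.
  have hl := Nat.mul_le_mul_right
    (Fintype.card S * (4 * (4 * φ.size) + 28) + 3 * edges.length + 5) b4
  rw [show 4 * (4 * φ.size) = 16 * φ.size by ring] at hl f1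
  simp only [hu, hua4, List.length_nil] at *
  exact ⟨by omega, by omega⟩

end Search

end FairLTL

-- Choice of the constant

theorem mainTheorem5 :
    ∃ C : ℕ, ∀ (AP S : Type) [Fintype AP] [DecidableEq AP] [Fintype S] [DecidableEq S]
      (K : FairLTL.Kripke AP S) (φ : FairLTL.Formula AP), φ.IsFair →
        FairLTL.fairMCTime K φ ≤ C * (K.size * 2 ^ φ.size) ∧
        FairLTL.fairMCSpace K φ ≤ C * (K.size + φ.size * 2 ^ φ.size) := by
  refine ⟨2000, fun AP S _ _ _ _ K φ _ => ?_⟩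
  obtain ⟨ht, hp⟩ := FairLTL.wp_fairMCListC (S := S) (states := Finset.univ.toList) (by simp)
    K.trans.toList K.label K.init φ ⟨0, K.size + φ.size, K.size + φ.size⟩
  change FairLTL.fairMCTime K φ ≤ _ at ht
  change FairLTL.fairMCSpace K φ ≤ _ at hp
  rw [Finset.length_toList] at ht hp
  have hK : K.size = Fintype.card S + K.trans.card := rfl
  have hS : 0 < Fintype.card S := Fintype.card_pos_iff.2 ⟨K.init⟩
  have hn := φ.size_pos
  have hlt : φ.size < 2 ^ φ.size := Nat.lt_two_pow_self
  have hB := FairLTL.sq_mul_countBound_le φ.size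
  have hB1 : φ.size * FairLTL.countBound φ.size ≤ φ.size ^ 2 * FairLTL.countBound φ.size :=
    Nat.mul_le_mul_right _ (Nat.le_self_pow two_ne_zero _)
  -- `640 = 40 * 16`.
  have hF : FairLTL.flattenBound φ.size ≤ 640 * 2 ^ φ.size := by
    unfold FairLTL.flattenBound
    omega
  generalize FairLTL.flattenBound φ.size = F at *
  generalize FairLTL.countBound φ.size = b at *
  generalize φ.size = n at *
  generalize 2 ^ n = P at *
  generalize Fintype.card S = s at *
  generalize K.trans.card = e at *
  rw [hK] at hp ⊢
  dsimp only at ht hp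
  constructor
  · have hPK : P ≤ (s + e) * P := Nat.le_mul_of_pos_left _ (by omega)
    have hKP : s + e ≤ (s + e) * P := Nat.le_mul_of_pos_right _ (by omega)
    have hloop : b * (s * (16 * n + 28) + 3 * e + 5) ≤ 49 * 16 * ((s + e) * P) := by
      -- `49 = 16 + 28 + 5`, using that `n` and `s` are at least 1; the factor `n * b` is then at
      -- most `16 * P`.
      have h1 : s * (16 * n + 28) + 3 * e + 5 ≤ 49 * (n * (s + e)) := by nlinarith
      calc b * (s * (16 * n + 28) + 3 * e + 5) ≤ b * (49 * (n * (s + e))) :=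
            Nat.mul_le_mul_left _ h1
        _ = 49 * (s + e) * (n * b) := by ring
        _ ≤ 49 * (s + e) * (16 * P) := Nat.mul_le_mul_left _ (by omega)
        _ = _ := by ring
    omega
  · have hPn : P ≤ n * P := Nat.le_mul_of_pos_left _ hn
    omega
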